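/- Let $\mathcal M$ be a symmetric monoidal category with product $\otimes$ and unit $\mathbb 1$. Let $\mathrm{Iso}(\mathcal M\downarrow\mathcal M)$ be the groupoid whose objects are the morphisms $\phi$ of $\mathcal M$ and whose morphisms $(\sigma\Downarrow\sigma'):\phi\to\phi'$ are the pairs of isomorphisms $\sigma:s(\phi)\to s(\phi')$, $\sigma':t(\phi)\to t(\phi')$ with $\phi'\circ\sigma=\sigma'\circ\phi$. It is symmetric monoidal for $\otimes$ taken objectwise, with unit $id_{\mathbb 1}$. When two morphisms $\phi,\phi'$ of $\mathcal M$ are equal, the corresponding objects are identified by $(id\Downarrow id)$. *The localized plus construction $\mathcal M^{loc+}$* is the symmetric monoidal category with product $\boxtimes$, whose objects are the $\boxtimes$-words in morphisms of $\mathcal M$, freely generated (as a symmetric monoidal category for $\boxtimes$) by the groupoid $\mathrm{Iso}(\mathcal M\downarrow\mathcal M)$ and by morphisms $$\gamma_{\phi_1,\phi_0}:\phi_1\boxtimes\phi_0\to\phi_1\circ\phi_0\ \ (\phi_1,\phi_0\text{ composable}),\qquad \mu_{\phi,\psi}:\phi\boxtimes\psi\to\phi\otimes\psi,\qquad \epsilon:\mathbb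 1_\boxtimes\to id_{\mathbb 1},$$ together with inverses $\mu_{\phi,\psi}^{-1}$ and $\epsilon^{-1}$ of all $\mu_{\phi,\psi}$ and of $\epsilon$, subject to the following relations. * Inner equivariance: $\gamma_{\phi_1\sigma^{-1},\,\sigma\phi_0}\circ\big((\sigma\Downarrow id)\boxtimes(id\Downarrow\sigma)\big)=\gamma_{\phi_1,\phi_0}$. * Outer equivariance: $\gamma_{\sigma'\phi_1,\,\phi_0\sigma^{-1}}\circ\big((id\Downarrow\sigma')\boxtimes(\sigma\Downarrow id)\big)=(\sigma\Downarrow\sigma')\circ\gamma_{\phi_1,\phi_0}$. * Internal associativity: $\gamma_{\phi_2\phi_1,\phi_0}\circ(\gamma_{\phi_2,\phi_1}\boxtimes id)=\gamma_{\phi_2,\phi_1\phi_0}\circ(id\boxtimes\gamma_{\phi_1,\phi_0})$, up to the associator of $\boxtimes$. * $\mu$ is natural with respect to $\mathrm{Iso}(\mathcal M\downarrow\mathcal M)$, and it is compatible with the associators and with the symmetries of $\boxtimes$ and $\otimes$. Together with $\epsilon$ it is compatible with the unit constraints of $\boxtimes$ and $\otimes$. * Internal interchange: $\gamma_{\phi_1\otimes\psi_1,\,\phi_0\otimes\psi_0}\circ(\mu_{\phi_1,\psi_1}\boxtimes\mu_{\phi_0,\psi_0})=\mu_{\phi_1\phi_0,\,\psi_1\psi_0}\circ(\gamma_{\phi_1,\phi_0}\boxtimes\gamma_{\psi_1,\psi_0})\circ\tau_{23}$,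 where $\tau_{23}$ exchanges the two middle factors of $\phi_1\boxtimes\psi_1\boxtimes\phi_0\boxtimes\psi_0$. *The reduced plus construction $\mathcal M^{+}$* is the symmetric monoidal category with product $\otimes$, whose objects are the morphisms of $\mathcal M$, obtained from the symmetric monoidal groupoid $\mathrm{Iso}(\mathcal M\downarrow\mathcal M)$ (with its product, unit and constraints) by freely adjoining morphisms $$\bar\gamma_{\phi_1,\phi_0}:\phi_1\otimes\phi_0\to\phi_1\circ\phi_0\qquad(\phi_1,\phi_0\text{ composable})$$ subject to inner equivariance, outer equivariance and internal associativity (as above, with $\otimes$ and $\bar\gamma$ in place of $\boxtimes$ and $\gamma$), and to internal interchange $$\bar\gamma_{\phi_1\otimes\psi_1,\,\phi_0\otimes\psi_0}=(\bar\gamma_{\phi_1,\phi_0}\otimes\bar\gamma_{\psi_1,\psi_0})\circ\tau_{23},$$ where now $\tau_{23}$ exchanges the two middle factors of $(\phi_1\otimes\psi_1)\otimes(\phi_0\otimes\psi_0)$. **Claim.** The underlying groupoid of $\mathcal M^+$ is $\mathrm{Iso}(\mathcal M\downarrow\mathcal M)$: for all morphisms $\phi,\phi'$ of $\mathcal M$,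 the canonical map from the morphisms $\phi\to\phi'$ of $\mathrm{Iso}(\mathcal M\downarrow\mathcal M)$ to the isomorphisms $\phi\to\phi'$ of $\mathcal M^+$ is a bijection. Moreover, $\mathcal M^{loc+}$ and $\mathcal M^+$ are symmetric monoidally equivalent: there is a symmetric strong monoidal functor $\mathcal M^{loc+}\to\mathcal M^+$ that is an equivalence of categories. (This holds for every symmetric monoidal category $\mathcal M$, in particular for those with factorizable isomorphisms.) -/

import Mathlib

open CategoryTheory MonoidalCategory

universe v u

namespace PlusConstruction

section Arrows

/-!
### The symmetric monoidal groupoid `Iso(M ↓ M)`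

Its objects are the morphisms of `M` (terms of `Arrow M`), its morphisms are the isomorphisms
`A ≅ B` of `Arrow M`, that is, the commutative squares `(σ ⇓ σ')` with `σ`, `σ'` invertible.
The tensor product, the unit and the constraints are those of `M`, taken on sources and targets.
-/

variable {M : Type u} [Category.{v} M] [MonoidalCategory M]

/-- The square `(σ ⇓ τ) : f ⟶ f'` with invertible vertical sides. -/
def cell {X Y X' Y' : M} {f : X ⟶ Y} {f' : X' ⟶ Y'} (σ : X ≅ X') (τ : Y ≅ Y')
    (h : σ.hom ≫ f' = f ≫ τ.hom) : Arrow.mk f ≅ Arrow.mk f' :=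
  Arrow.isoMk σ τ h

/-- Equal parallel morphisms `f = f'` are identified by the square `(id ⇓ id)`. -/
def cellOfEq {X Y : M} {f f' : X ⟶ Y} (h : f = f') : Arrow.mk f ≅ Arrow.mk f' :=
  cell (Iso.refl X) (Iso.refl Y) (by simp [h])

/-- The tensor product `φ ⊗ ψ` of two morphisms, as an object of `Iso(M ↓ M)`. -/
def arrTensor (A B : Arrow M) : Arrow M := Arrow.mk (A.hom ⊗ₘ B.hom)

variable (M) in
/-- The unit `id_𝟙` of `Iso(M ↓ M)`. -/
def arrUnit : Arrow M := Arrow.mk (𝟙 (𝟙_ M))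

/-- `(σ₁ ⇓ σ₁') ⊗ (σ₂ ⇓ σ₂') = (σ₁ ⊗ σ₂ ⇓ σ₁' ⊗ σ₂')`. -/
def arrTensorIso {A A' B B' : Arrow M} (e : A ≅ A') (f : B ≅ B') :
    arrTensor A B ≅ arrTensor A' B' :=
  Arrow.isoMk (Arrow.leftFunc.mapIso e ⊗ᵢ Arrow.leftFunc.mapIso f)
    (Arrow.rightFunc.mapIso e ⊗ᵢ Arrow.rightFunc.mapIso f) (by
      change (e.hom.left ⊗ₘ f.hom.left) ≫ (A'.hom ⊗ₘ B'.hom) =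
        (A.hom ⊗ₘ B.hom) ≫ (e.hom.right ⊗ₘ f.hom.right)
      rw [tensorHom_comp_tensorHom, tensorHom_comp_tensorHom, Arrow.w, Arrow.w])

/-- The associator of `Iso(M ↓ M)`. -/
def arrAssoc (A B C : Arrow M) :
    arrTensor (arrTensor A B) C ≅ arrTensor A (arrTensor B C) :=
  Arrow.isoMk (α_ A.left B.left C.left) (α_ A.right B.right C.right)
    (associator_naturality A.hom B.hom C.hom).symm

/-- The left unit constraint of `Iso(M ↓ M)`. -/
def arrLeftUnitor (A : Arrow M) : arrTensor (arrUnit M) A ≅ A :=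
  Arrow.isoMk (λ_ A.left) (λ_ A.right) (by simp [arrTensor, arrUnit])

/-- The right unit constraint of `Iso(M ↓ M)`. -/
def arrRightUnitor (A : Arrow M) : arrTensor A (arrUnit M) ≅ A :=
  Arrow.isoMk (ρ_ A.left) (ρ_ A.right) (by simp [arrTensor, arrUnit])

/-- The commutativity constraint of `Iso(M ↓ M)`. -/
def arrBraid [SymmetricCategory M] (A B : Arrow M) : arrTensor A B ≅ arrTensor B A :=
  Arrow.isoMk (β_ A.left B.left) (β_ A.right B.right) (by simp [arrTensor])

/-- The exchange of the two middle factors in `Iso(M ↓ M)`. -/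
def arrMiddle [SymmetricCategory M] (A B C D : Arrow M) :
    arrTensor (arrTensor A B) (arrTensor C D) ≅ arrTensor (arrTensor A C) (arrTensor B D) :=
  arrAssoc A B (arrTensor C D) ≪≫
    arrTensorIso (Iso.refl A)
      ((arrAssoc B C D).symm ≪≫ arrTensorIso (arrBraid B C) (Iso.refl D) ≪≫ arrAssoc C B D) ≪≫
    (arrAssoc A C (arrTensor B D)).symm

/-- The square `(id ⇓ id)` identifying `(φ₀ ⊗ ψ₀) ∘ (φ₁ ⊗ ψ₁)` with `(φ₀ ∘ φ₁) ⊗ (ψ₀ ∘ ψ₁)`. -/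
def arrInterchange {X Y Z X' Y' Z' : M} (g : Y ⟶ Z) (g' : Y' ⟶ Z') (f : X ⟶ Y) (f' : X' ⟶ Y') :
    Arrow.mk ((f ⊗ₘ f') ≫ (g ⊗ₘ g')) ≅ arrTensor (Arrow.mk (f ≫ g)) (Arrow.mk (f' ≫ g')) :=
  cellOfEq (tensorHom_comp_tensorHom f f' g g')

end Arrows

/-!
### The localized plus construction

It is the symmetric monoidal category presented, as a symmetric monoidal category with product `⊠`,
by the groupoid `Iso(M ↓ M)`, the generators `γ`, `μ`, `ε`, the inverses of `μ` and `ε`, and the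
relations listed in `LocRel`. Leaving out the two inverses gives the non-connected plus
construction, and leaving out `μ` and `ε` as well gives the plus construction of the category `M`.
-/

section Loc

/-- The objects: formal (bracketed) `⊠`-words in the morphisms of `M`. -/
inductive MLocPlus (M : Type u) [Category.{v} M] : Type (max u v)
  | of (A : Arrow M) : MLocPlus M
  | unit : MLocPlus M
  | tensor (P Q : MLocPlus M) : MLocPlus M

namespace MLocPlus

variable {M : Type u} [Category.{v} M] [MonoidalCategory M]

/-- Formal morphisms: the generators, closed under composition and `⊠`. -/
inductive LocHom : MLocPlus M → MLocPlus M → Type (max u v)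
  | id (P : MLocPlus M) : LocHom P P
  | comp {P Q R : MLocPlus M} (p : LocHom P Q) (q : LocHom Q R) : LocHom P R
  | tensor {P P' Q Q' : MLocPlus M} (p : LocHom P P') (q : LocHom Q Q') :
      LocHom (P.tensor Q) (P'.tensor Q')
  | assocHom (P Q R : MLocPlus M) : LocHom ((P.tensor Q).tensor R) (P.tensor (Q.tensor R))
  | assocInv (P Q R : MLocPlus M) : LocHom (P.tensor (Q.tensor R)) ((P.tensor Q).tensor R)
  | leftHom (P : MLocPlus M) : LocHom (unit.tensor P) P
  | leftInv (P : MLocPlus M) : LocHom P (unit.tensor P)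
  | rightHom (P : MLocPlus M) : LocHom (P.tensor unit) P
  | rightInv (P : MLocPlus M) : LocHom P (P.tensor unit)
  | braid (P Q : MLocPlus M) : LocHom (P.tensor Q) (Q.tensor P)
  /-- the morphisms of `Iso(M ↓ M)` -/
  | iso {A B : Arrow M} (e : A ≅ B) : LocHom (of A) (of B)
  /-- `γ_{g,f} : g ⊠ f → g ∘ f` -/
  | gamma {X Y Z : M} (g : Y ⟶ Z) (f : X ⟶ Y) :
      LocHom ((of (Arrow.mk g)).tensor (of (Arrow.mk f))) (of (Arrow.mk (f ≫ g)))
  /-- `μ_{φ,ψ} : φ ⊠ ψ → φ ⊗ ψ` -/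
  | mu (A B : Arrow M) : LocHom ((of A).tensor (of B)) (of (arrTensor A B))
  | muInv (A B : Arrow M) : LocHom (of (arrTensor A B)) ((of A).tensor (of B))
  /-- `ε : 𝟙_⊠ → id_𝟙` -/
  | eps : LocHom unit (of (arrUnit M))
  | epsInv : LocHom (of (arrUnit M)) unit

/-- The formal exchange of the two middle factors of a four-fold `⊠`-product. -/
def LocHom.middle (P Q R S : MLocPlus M) :
    LocHom ((P.tensor Q).tensor (R.tensor S)) ((P.tensor R).tensor (Q.tensor S)) :=
  ((assocHom P Q (R.tensor S)).comp
    ((LocHom.id P).tensor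
      (((assocInv Q R S).comp ((braid Q R).tensor (LocHom.id S))).comp (assocHom R Q S)))).comp
    (assocInv P R (Q.tensor S))

open LocHom in
/-- The relations. -/
inductive LocRel [SymmetricCategory M] :
    ∀ {P Q : MLocPlus M}, LocHom P Q → LocHom P Q → Prop
  -- congruence
  | refl {P Q : MLocPlus M} (p : LocHom P Q) : LocRel p p
  | symm {P Q : MLocPlus M} {p q : LocHom P Q} : LocRel p q → LocRel q p
  | trans {P Q : MLocPlus M} {p q r : LocHom P Q} : LocRel p q → LocRel q r → LocRel p r
  | comp_congr {P Q R : MLocPlus M} {p p' : LocHom P Q} {q q' : LocHom Q R} :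
      LocRel p p' → LocRel q q' → LocRel (p.comp q) (p'.comp q')
  | tensor_congr {P P' Q Q' : MLocPlus M} {p p' : LocHom P P'} {q q' : LocHom Q Q'} :
      LocRel p p' → LocRel q q' → LocRel (p.tensor q) (p'.tensor q')
  -- axioms of a symmetric monoidal category
  | id_comp {P Q : MLocPlus M} (p : LocHom P Q) : LocRel ((LocHom.id P).comp p) p
  | comp_id {P Q : MLocPlus M} (p : LocHom P Q) : LocRel (p.comp (LocHom.id Q)) p
  | assoc {P Q R S : MLocPlus M} (p : LocHom P Q) (q : LocHom Q R) (r : LocHom R S) :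
      LocRel ((p.comp q).comp r) (p.comp (q.comp r))
  | tensor_id (P Q : MLocPlus M) :
      LocRel ((LocHom.id P).tensor (LocHom.id Q)) (LocHom.id (P.tensor Q))
  | tensor_comp {P P' P'' Q Q' Q'' : MLocPlus M} (p : LocHom P P') (q : LocHom Q Q')
      (p' : LocHom P' P'') (q' : LocHom Q' Q'') :
      LocRel ((p.tensor q).comp (p'.tensor q')) ((p.comp p').tensor (q.comp q'))
  | assoc_hom_inv (P Q R : MLocPlus M) :
      LocRel ((assocHom P Q R).comp (assocInv P Q R)) (LocHom.id _)
  | assoc_inv_hom (P Q R : MLocPlus M) :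
      LocRel ((assocInv P Q R).comp (assocHom P Q R)) (LocHom.id _)
  | assoc_naturality {P P' Q Q' R R' : MLocPlus M} (p : LocHom P P') (q : LocHom Q Q')
      (r : LocHom R R') :
      LocRel (((p.tensor q).tensor r).comp (assocHom P' Q' R'))
        ((assocHom P Q R).comp (p.tensor (q.tensor r)))
  | left_hom_inv (P : MLocPlus M) : LocRel ((leftHom P).comp (leftInv P)) (LocHom.id _)
  | left_inv_hom (P : MLocPlus M) : LocRel ((leftInv P).comp (leftHom P)) (LocHom.id _)
  | left_naturality {P Q : MLocPlus M} (p : LocHom P Q) :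
      LocRel (((LocHom.id unit).tensor p).comp (leftHom Q)) ((leftHom P).comp p)
  | right_hom_inv (P : MLocPlus M) : LocRel ((rightHom P).comp (rightInv P)) (LocHom.id _)
  | right_inv_hom (P : MLocPlus M) : LocRel ((rightInv P).comp (rightHom P)) (LocHom.id _)
  | right_naturality {P Q : MLocPlus M} (p : LocHom P Q) :
      LocRel ((p.tensor (LocHom.id unit)).comp (rightHom Q)) ((rightHom P).comp p)
  | pentagon (P Q R S : MLocPlus M) :
      LocRel (((assocHom P Q R).tensor (LocHom.id S)).comp
          ((assocHom P (Q.tensor R) S).comp ((LocHom.id P).tensor (assocHom Q R S))))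
        ((assocHom (P.tensor Q) R S).comp (assocHom P Q (R.tensor S)))
  | triangle (P Q : MLocPlus M) :
      LocRel ((assocHom P unit Q).comp ((LocHom.id P).tensor (leftHom Q)))
        ((rightHom P).tensor (LocHom.id Q))
  | braid_naturality {P P' Q Q' : MLocPlus M} (p : LocHom P P') (q : LocHom Q Q') :
      LocRel ((p.tensor q).comp (braid P' Q')) ((braid P Q).comp (q.tensor p))
  | braid_braid (P Q : MLocPlus M) : LocRel ((braid P Q).comp (braid Q P)) (LocHom.id _)
  | hexagon (P Q R : MLocPlus M) :
      LocRel ((assocHom P Q R).comp ((braid P (Q.tensor R)).comp (assocHom Q R P)))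
        (((braid P Q).tensor (LocHom.id R)).comp
          ((assocHom Q P R).comp ((LocHom.id Q).tensor (braid P R))))
  -- `Iso(M ↓ M)` maps functorially
  | iso_refl (A : Arrow M) : LocRel (iso (Iso.refl A)) (LocHom.id (of A))
  | iso_trans {A B C : Arrow M} (e : A ≅ B) (f : B ≅ C) :
      LocRel (iso (e ≪≫ f)) ((iso e).comp (iso f))
  -- relations for `γ`
  | gamma_inner {X Y Y' Z : M} (g : Y ⟶ Z) (f : X ⟶ Y) (σ : Y ≅ Y') :
      LocRel
        (((iso (cell σ (Iso.refl Z) (by simp) : Arrow.mk g ≅ Arrow.mk (σ.inv ≫ g))).tensor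
          (iso (cell (Iso.refl X) σ (by simp) : Arrow.mk f ≅ Arrow.mk (f ≫ σ.hom)))).comp
          (gamma (σ.inv ≫ g) (f ≫ σ.hom)))
        ((gamma g f).comp
          (iso (cellOfEq (by simp) : Arrow.mk (f ≫ g) ≅ Arrow.mk ((f ≫ σ.hom) ≫ σ.inv ≫ g))))
  | gamma_outer {X X' Y Z Z' : M} (g : Y ⟶ Z) (f : X ⟶ Y) (σ : X ≅ X') (τ : Z ≅ Z') :
      LocRel
        (((iso (cell (Iso.refl Y) τ (by simp) : Arrow.mk g ≅ Arrow.mk (g ≫ τ.hom))).tensor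
          (iso (cell σ (Iso.refl Y) (by simp) : Arrow.mk f ≅ Arrow.mk (σ.inv ≫ f)))).comp
          (gamma (g ≫ τ.hom) (σ.inv ≫ f)))
        ((gamma g f).comp
          (iso (cell σ τ (by simp) : Arrow.mk (f ≫ g) ≅ Arrow.mk ((σ.inv ≫ f) ≫ g ≫ τ.hom))))
  | gamma_assoc {W X Y Z : M} (h : Y ⟶ Z) (g : X ⟶ Y) (f : W ⟶ X) :
      LocRel
        (((gamma h g).tensor (LocHom.id (of (Arrow.mk f)))).comp (gamma (g ≫ h) f))
        ((assocHom (of (Arrow.mk h)) (of (Arrow.mk g)) (of (Arrow.mk f))).comp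
          (((LocHom.id (of (Arrow.mk h))).tensor (gamma g f)).comp
            ((gamma h (f ≫ g)).comp (iso (cellOfEq (Category.assoc f g h))))))
  -- relations for `μ` and `ε`
  | mu_equivariant {A A' B B' : Arrow M} (e : A ≅ A') (f : B ≅ B') :
      LocRel (((iso e).tensor (iso f)).comp (mu A' B')) ((mu A B).comp (iso (arrTensorIso e f)))
  | mu_assoc (A B C : Arrow M) :
      LocRel
        (((mu A B).tensor (LocHom.id (of C))).comp
          ((mu (arrTensor A B) C).comp (iso (arrAssoc A B C))))
        ((assocHom (of A) (of B) (of C)).comp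
          (((LocHom.id (of A)).tensor (mu B C)).comp (mu A (arrTensor B C))))
  | mu_left_unit (A : Arrow M) :
      LocRel ((eps.tensor (LocHom.id (of A))).comp ((mu (arrUnit M) A).comp (iso (arrLeftUnitor A))))
        (leftHom (of A))
  | mu_right_unit (A : Arrow M) :
      LocRel
        (((LocHom.id (of A)).tensor eps).comp ((mu A (arrUnit M)).comp (iso (arrRightUnitor A))))
        (rightHom (of A))
  | interchange {X Y Z X' Y' Z' : M} (g : Y ⟶ Z) (g' : Y' ⟶ Z') (f : X ⟶ Y) (f' : X' ⟶ Y') :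
      LocRel
        (((mu (Arrow.mk g) (Arrow.mk g')).tensor (mu (Arrow.mk f) (Arrow.mk f'))).comp
          ((gamma (g ⊗ₘ g') (f ⊗ₘ f')).comp (iso (arrInterchange g g' f f'))))
        ((middle (of (Arrow.mk g)) (of (Arrow.mk g')) (of (Arrow.mk f)) (of (Arrow.mk f'))).comp
          (((gamma g f).tensor (gamma g' f')).comp (mu (Arrow.mk (f ≫ g)) (Arrow.mk (f' ≫ g')))))
  | mu_commutator (A B : Arrow M) :
      LocRel ((mu A B).comp (iso (arrBraid A B))) ((braid (of A) (of B)).comp (mu B A))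
  -- localization
  | mu_hom_inv (A B : Arrow M) : LocRel ((mu A B).comp (muInv A B)) (LocHom.id _)
  | mu_inv_hom (A B : Arrow M) : LocRel ((muInv A B).comp (mu A B)) (LocHom.id _)
  | eps_hom_inv : LocRel (eps.comp epsInv) (LocHom.id (unit : MLocPlus M))
  | eps_inv_hom : LocRel (epsInv.comp eps) (LocHom.id (of (arrUnit M)))

variable [SymmetricCategory M]

/-- Two formal morphisms are identified when the relations make them equal. -/
instance locSetoid (P Q : MLocPlus M) : Setoid (LocHom P Q) :=
  ⟨LocRel, ⟨LocRel.refl, LocRel.symm, LocRel.trans⟩⟩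

instance : Category.{max u v} (MLocPlus M) where
  Hom P Q := Quotient (locSetoid P Q)
  id P := ⟦LocHom.id P⟧
  comp := Quotient.map₂ LocHom.comp (fun _ _ hp _ _ hq => LocRel.comp_congr hp hq)
  id_comp := by
    rintro P Q ⟨p⟩
    exact Quotient.sound (LocRel.id_comp p)
  comp_id := by
    rintro P Q ⟨p⟩
    exact Quotient.sound (LocRel.comp_id p)
  assoc := by
    rintro P Q R S ⟨p⟩ ⟨q⟩ ⟨r⟩
    exact Quotient.sound (LocRel.assoc p q r)

instance : MonoidalCategoryStruct (MLocPlus M) where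
  tensorObj P Q := P.tensor Q
  tensorUnit := MLocPlus.unit
  tensorHom := Quotient.map₂ LocHom.tensor (fun _ _ hp _ _ hq => LocRel.tensor_congr hp hq)
  whiskerLeft P _ _ q :=
    Quotient.map₂ LocHom.tensor (fun _ _ hp _ _ hq => LocRel.tensor_congr hp hq) ⟦LocHom.id P⟧ q
  whiskerRight p Q :=
    Quotient.map₂ LocHom.tensor (fun _ _ hp _ _ hq => LocRel.tensor_congr hp hq) p ⟦LocHom.id Q⟧
  associator P Q R :=
    ⟨⟦LocHom.assocHom P Q R⟧, ⟦LocHom.assocInv P Q R⟧,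
      Quotient.sound (LocRel.assoc_hom_inv P Q R), Quotient.sound (LocRel.assoc_inv_hom P Q R)⟩
  leftUnitor P :=
    ⟨⟦LocHom.leftHom P⟧, ⟦LocHom.leftInv P⟧,
      Quotient.sound (LocRel.left_hom_inv P), Quotient.sound (LocRel.left_inv_hom P)⟩
  rightUnitor P :=
    ⟨⟦LocHom.rightHom P⟧, ⟦LocHom.rightInv P⟧,
      Quotient.sound (LocRel.right_hom_inv P), Quotient.sound (LocRel.right_inv_hom P)⟩

/-- The monoidal structure `⊠`. -/
instance : MonoidalCategory (MLocPlus M) :=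
  MonoidalCategory.ofTensorHom
    (id_tensorHom_id := fun P Q => Quotient.sound (LocRel.tensor_id P Q))
    (id_tensorHom := fun _ _ _ _ => rfl)
    (tensorHom_id := fun _ _ => rfl)
    (tensorHom_comp_tensorHom := by
      rintro _ _ _ _ _ _ ⟨p⟩ ⟨q⟩ ⟨p'⟩ ⟨q'⟩
      exact Quotient.sound (LocRel.tensor_comp p q p' q'))
    (associator_naturality := by
      rintro _ _ _ _ _ _ ⟨p⟩ ⟨q⟩ ⟨r⟩
      exact Quotient.sound (LocRel.assoc_naturality p q r))
    (leftUnitor_naturality := by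
      rintro _ _ ⟨p⟩
      exact Quotient.sound (LocRel.left_naturality p))
    (rightUnitor_naturality := by
      rintro _ _ ⟨p⟩
      exact Quotient.sound (LocRel.right_naturality p))
    (pentagon := fun P Q R S => Quotient.sound (LocRel.pentagon P Q R S))
    (triangle := fun P Q => Quotient.sound (LocRel.triangle P Q))

/-- The commutativity constraint of `⊠`. -/
def braidIso (P Q : MLocPlus M) : P ⊗ Q ≅ Q ⊗ P :=
  ⟨⟦LocHom.braid P Q⟧, ⟦LocHom.braid Q P⟧,
    Quotient.sound (LocRel.braid_braid P Q), Quotient.sound (LocRel.braid_braid Q P)⟩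

theorem braidIso_hexagon (P Q R : MLocPlus M) :
    (α_ P Q R).hom ≫ (braidIso P (Q ⊗ R)).hom ≫ (α_ Q R P).hom =
      ((braidIso P Q).hom ▷ R) ≫ (α_ Q P R).hom ≫ (Q ◁ (braidIso P R).hom) :=
  Quotient.sound (LocRel.hexagon P Q R)

instance : SymmetricCategory (MLocPlus M) where
  braiding := braidIso
  braiding_naturality_right := by
    rintro P _ _ ⟨q⟩
    exact Quotient.sound (LocRel.braid_naturality (LocHom.id P) q)
  braiding_naturality_left := by
    rintro _ _ ⟨p⟩ Q
    exact Quotient.sound (LocRel.braid_naturality p (LocHom.id Q))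
  hexagon_forward := braidIso_hexagon
  hexagon_reverse P Q R := by
    have h : α_ R P Q ≪≫ braidIso R (P ⊗ Q) ≪≫ α_ P Q R =
        whiskerRightIso (braidIso R P) Q ≪≫ α_ P R Q ≪≫ whiskerLeftIso P (braidIso R Q) :=
      Iso.ext (braidIso_hexagon R P Q)
    have h' := congrArg Iso.inv h
    simp only [Iso.trans_inv, Category.assoc] at h'
    exact h'
  symmetry P Q := Quotient.sound (LocRel.braid_braid P Q)

end MLocPlus

end Loc

/-!
### The reduced plus construction

It is the symmetric monoidal category with product `⊗` obtained from the symmetric monoidal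
groupoid `Iso(M ↓ M)` by adjoining the generators `γ̄` subject to the relations listed in
`PlusRel`; no new objects are added.
-/

section Plus

/-- The objects: the morphisms of `M`. -/
structure MPlus (M : Type u) [Category.{v} M] where
  /-- the underlying morphism of `M` -/
  arrow : Arrow M

namespace MPlus

variable {M : Type u} [Category.{v} M] [MonoidalCategory M]

/-- Formal morphisms: the generators, closed under composition and `⊗`. -/
inductive PlusHom : Arrow M → Arrow M → Type (max u v)
  | comp {A B C : Arrow M} (p : PlusHom A B) (q : PlusHom B C) : PlusHom A C
  | tensor {A A' B B' : Arrow M} (p : PlusHom A A') (q : PlusHom B B') :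
      PlusHom (arrTensor A B) (arrTensor A' B')
  /-- the morphisms of `Iso(M ↓ M)` -/
  | iso {A B : Arrow M} (e : A ≅ B) : PlusHom A B
  /-- `γ̄_{g,f} : g ⊗ f → g ∘ f` -/
  | gamma {X Y Z : M} (g : Y ⟶ Z) (f : X ⟶ Y) :
      PlusHom (arrTensor (Arrow.mk g) (Arrow.mk f)) (Arrow.mk (f ≫ g))

/-- The identity of `A`. -/
def PlusHom.id (A : Arrow M) : PlusHom A A := .iso (Iso.refl A)

open PlusHom in
/-- The relations. -/
inductive PlusRel [SymmetricCategory M] :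
    ∀ {A B : Arrow M}, PlusHom A B → PlusHom A B → Prop
  -- congruence
  | refl {A B : Arrow M} (p : PlusHom A B) : PlusRel p p
  | symm {A B : Arrow M} {p q : PlusHom A B} : PlusRel p q → PlusRel q p
  | trans {A B : Arrow M} {p q r : PlusHom A B} : PlusRel p q → PlusRel q r → PlusRel p r
  | comp_congr {A B C : Arrow M} {p p' : PlusHom A B} {q q' : PlusHom B C} :
      PlusRel p p' → PlusRel q q' → PlusRel (p.comp q) (p'.comp q')
  | tensor_congr {A A' B B' : Arrow M} {p p' : PlusHom A A'} {q q' : PlusHom B B'} :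
      PlusRel p p' → PlusRel q q' → PlusRel (p.tensor q) (p'.tensor q')
  -- axioms of a symmetric monoidal category with the constraints of `Iso(M ↓ M)`
  | id_comp {A B : Arrow M} (p : PlusHom A B) : PlusRel ((PlusHom.id A).comp p) p
  | comp_id {A B : Arrow M} (p : PlusHom A B) : PlusRel (p.comp (PlusHom.id B)) p
  | assoc {A B C D : Arrow M} (p : PlusHom A B) (q : PlusHom B C) (r : PlusHom C D) :
      PlusRel ((p.comp q).comp r) (p.comp (q.comp r))
  | tensor_comp {A A' A'' B B' B'' : Arrow M} (p : PlusHom A A') (q : PlusHom B B')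
      (p' : PlusHom A' A'') (q' : PlusHom B' B'') :
      PlusRel ((p.tensor q).comp (p'.tensor q')) ((p.comp p').tensor (q.comp q'))
  | assoc_naturality {A A' B B' C C' : Arrow M} (p : PlusHom A A') (q : PlusHom B B')
      (r : PlusHom C C') :
      PlusRel (((p.tensor q).tensor r).comp (iso (arrAssoc A' B' C')))
        ((iso (arrAssoc A B C)).comp (p.tensor (q.tensor r)))
  | left_naturality {A B : Arrow M} (p : PlusHom A B) :
      PlusRel (((PlusHom.id (arrUnit M)).tensor p).comp (iso (arrLeftUnitor B)))
        ((iso (arrLeftUnitor A)).comp p)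
  | right_naturality {A B : Arrow M} (p : PlusHom A B) :
      PlusRel ((p.tensor (PlusHom.id (arrUnit M))).comp (iso (arrRightUnitor B)))
        ((iso (arrRightUnitor A)).comp p)
  | braid_naturality {A A' B B' : Arrow M} (p : PlusHom A A') (q : PlusHom B B') :
      PlusRel ((p.tensor q).comp (iso (arrBraid A' B'))) ((iso (arrBraid A B)).comp (q.tensor p))
  -- `Iso(M ↓ M)` maps functorially and compatibly with `⊗`
  | iso_trans {A B C : Arrow M} (e : A ≅ B) (f : B ≅ C) :
      PlusRel (iso (e ≪≫ f)) ((iso e).comp (iso f))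
  | iso_tensor {A A' B B' : Arrow M} (e : A ≅ A') (f : B ≅ B') :
      PlusRel (iso (arrTensorIso e f)) ((iso e).tensor (iso f))
  -- relations for `γ̄`
  | gamma_inner {X Y Y' Z : M} (g : Y ⟶ Z) (f : X ⟶ Y) (σ : Y ≅ Y') :
      PlusRel
        (((iso (cell σ (Iso.refl Z) (by simp) : Arrow.mk g ≅ Arrow.mk (σ.inv ≫ g))).tensor
          (iso (cell (Iso.refl X) σ (by simp) : Arrow.mk f ≅ Arrow.mk (f ≫ σ.hom)))).comp
          (gamma (σ.inv ≫ g) (f ≫ σ.hom)))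
        ((gamma g f).comp
          (iso (cellOfEq (by simp) : Arrow.mk (f ≫ g) ≅ Arrow.mk ((f ≫ σ.hom) ≫ σ.inv ≫ g))))
  | gamma_outer {X X' Y Z Z' : M} (g : Y ⟶ Z) (f : X ⟶ Y) (σ : X ≅ X') (τ : Z ≅ Z') :
      PlusRel
        (((iso (cell (Iso.refl Y) τ (by simp) : Arrow.mk g ≅ Arrow.mk (g ≫ τ.hom))).tensor
          (iso (cell σ (Iso.refl Y) (by simp) : Arrow.mk f ≅ Arrow.mk (σ.inv ≫ f)))).comp
          (gamma (g ≫ τ.hom) (σ.inv ≫ f)))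
        ((gamma g f).comp
          (iso (cell σ τ (by simp) : Arrow.mk (f ≫ g) ≅ Arrow.mk ((σ.inv ≫ f) ≫ g ≫ τ.hom))))
  | gamma_assoc {W X Y Z : M} (h : Y ⟶ Z) (g : X ⟶ Y) (f : W ⟶ X) :
      PlusRel
        (((gamma h g).tensor (PlusHom.id (Arrow.mk f))).comp (gamma (g ≫ h) f))
        ((iso (arrAssoc (Arrow.mk h) (Arrow.mk g) (Arrow.mk f))).comp
          (((PlusHom.id (Arrow.mk h)).tensor (gamma g f)).comp
            ((gamma h (f ≫ g)).comp (iso (cellOfEq (Category.assoc f g h))))))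
  | interchange {X Y Z X' Y' Z' : M} (g : Y ⟶ Z) (g' : Y' ⟶ Z') (f : X ⟶ Y) (f' : X' ⟶ Y') :
      PlusRel
        ((gamma (g ⊗ₘ g') (f ⊗ₘ f')).comp (iso (arrInterchange g g' f f')))
        ((iso (arrMiddle (Arrow.mk g) (Arrow.mk g') (Arrow.mk f) (Arrow.mk f'))).comp
          ((gamma g f).tensor (gamma g' f')))

variable [SymmetricCategory M]

/-- Two formal morphisms are identified when the relations make them equal. -/
instance plusSetoid (A B : Arrow M) : Setoid (PlusHom A B) :=
  ⟨PlusRel, ⟨PlusRel.refl, PlusRel.symm, PlusRel.trans⟩⟩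

instance : Category.{max u v} (MPlus M) where
  Hom P Q := Quotient (plusSetoid P.arrow Q.arrow)
  id P := ⟦PlusHom.id P.arrow⟧
  comp := Quotient.map₂ PlusHom.comp (fun _ _ hp _ _ hq => PlusRel.comp_congr hp hq)
  id_comp := by
    rintro P Q ⟨p⟩
    exact Quotient.sound (PlusRel.id_comp p)
  comp_id := by
    rintro P Q ⟨p⟩
    exact Quotient.sound (PlusRel.comp_id p)
  assoc := by
    rintro P Q R S ⟨p⟩ ⟨q⟩ ⟨r⟩
    exact Quotient.sound (PlusRel.assoc p q r)

/-- The morphism of the reduced plus construction given by a morphism of `Iso(M ↓ M)`. -/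
def homOf {A B : Arrow M} (e : A ≅ B) : MPlus.mk A ⟶ MPlus.mk B := ⟦PlusHom.iso e⟧

theorem homOf_refl (A : Arrow M) : homOf (Iso.refl A) = 𝟙 (MPlus.mk A) := rfl

theorem homOf_trans {A B C : Arrow M} (e : A ≅ B) (f : B ≅ C) :
    homOf (e ≪≫ f) = homOf e ≫ homOf f :=
  Quotient.sound (PlusRel.iso_trans e f)

/-- The functor from `Iso(M ↓ M)` to the underlying groupoid of the reduced plus construction;
it is bijective on objects. -/
def isoOf {A B : Arrow M} (e : A ≅ B) : MPlus.mk A ≅ MPlus.mk B where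
  hom := homOf e
  inv := homOf e.symm
  hom_inv_id := by rw [← homOf_trans, Iso.self_symm_id, homOf_refl]
  inv_hom_id := by rw [← homOf_trans, Iso.symm_self_id, homOf_refl]

instance : MonoidalCategoryStruct (MPlus M) where
  tensorObj P Q := ⟨arrTensor P.arrow Q.arrow⟩
  tensorUnit := ⟨arrUnit M⟩
  tensorHom := Quotient.map₂ PlusHom.tensor (fun _ _ hp _ _ hq => PlusRel.tensor_congr hp hq)
  whiskerLeft P _ _ q :=
    Quotient.map₂ PlusHom.tensor (fun _ _ hp _ _ hq => PlusRel.tensor_congr hp hq)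
      ⟦PlusHom.id P.arrow⟧ q
  whiskerRight p Q :=
    Quotient.map₂ PlusHom.tensor (fun _ _ hp _ _ hq => PlusRel.tensor_congr hp hq)
      p ⟦PlusHom.id Q.arrow⟧
  associator P Q R := isoOf (arrAssoc P.arrow Q.arrow R.arrow)
  leftUnitor P := isoOf (arrLeftUnitor P.arrow)
  rightUnitor P := isoOf (arrRightUnitor P.arrow)

theorem homOf_tensor {A A' B B' : Arrow M} (e : A ≅ A') (f : B ≅ B') :
    homOf (arrTensorIso e f) = homOf e ⊗ₘ homOf f :=
  Quotient.sound (PlusRel.iso_tensor e f)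

/-- The monoidal structure `⊗`. -/
instance : MonoidalCategory (MPlus M) :=
  MonoidalCategory.ofTensorHom
    (id_tensorHom_id := fun P Q => by
      refine (homOf_tensor (Iso.refl P.arrow) (Iso.refl Q.arrow)).symm.trans ?_
      refine (congrArg homOf ?_).trans (homOf_refl _)
      have key (X Y : M) : 𝟙 X ⊗ₘ 𝟙 Y = 𝟙 (X ⊗ Y) := by simp
      exact Iso.ext (Arrow.hom_ext _ _ (key _ _) (key _ _)))
    (id_tensorHom := fun _ _ _ _ => rfl)
    (tensorHom_id := fun _ _ => rfl)
    (tensorHom_comp_tensorHom := by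
      rintro _ _ _ _ _ _ ⟨p⟩ ⟨q⟩ ⟨p'⟩ ⟨q'⟩
      exact Quotient.sound (PlusRel.tensor_comp p q p' q'))
    (associator_naturality := by
      rintro _ _ _ _ _ _ ⟨p⟩ ⟨q⟩ ⟨r⟩
      exact Quotient.sound (PlusRel.assoc_naturality p q r))
    (leftUnitor_naturality := by
      rintro _ _ ⟨p⟩
      exact Quotient.sound (PlusRel.left_naturality p))
    (rightUnitor_naturality := by
      rintro _ _ ⟨p⟩
      exact Quotient.sound (PlusRel.right_naturality p))
    (pentagon := fun P Q R S => by
      have h : arrTensorIso (arrAssoc P.arrow Q.arrow R.arrow) (Iso.refl S.arrow) ≪≫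
          arrAssoc P.arrow (arrTensor Q.arrow R.arrow) S.arrow ≪≫
            arrTensorIso (Iso.refl P.arrow) (arrAssoc Q.arrow R.arrow S.arrow) =
          arrAssoc (arrTensor P.arrow Q.arrow) R.arrow S.arrow ≪≫
            arrAssoc P.arrow Q.arrow (arrTensor R.arrow S.arrow) := by
        have key (W X Y Z : M) : ((α_ W X Y).hom ⊗ₘ 𝟙 Z) ≫ (α_ W (X ⊗ Y) Z).hom ≫
            (𝟙 W ⊗ₘ (α_ X Y Z).hom) = (α_ (W ⊗ X) Y Z).hom ≫ (α_ W X (Y ⊗ Z)).hom := by simp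
        exact Iso.ext (Arrow.hom_ext _ _ (key _ _ _ _) (key _ _ _ _))
      have h' := congrArg homOf h
      simp only [homOf_trans, homOf_tensor, homOf_refl] at h'
      exact h')
    (triangle := fun P Q => by
      have h : arrAssoc P.arrow (arrUnit M) Q.arrow ≪≫
          arrTensorIso (Iso.refl P.arrow) (arrLeftUnitor Q.arrow) =
          arrTensorIso (arrRightUnitor P.arrow) (Iso.refl Q.arrow) := by
        have key (X Y : M) : (α_ X (𝟙_ M) Y).hom ≫ (𝟙 X ⊗ₘ (λ_ Y).hom) =
            (ρ_ X).hom ⊗ₘ 𝟙 Y := by simp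
        exact Iso.ext (Arrow.hom_ext _ _ (key _ _) (key _ _))
      have h' := congrArg homOf h
      simp only [homOf_trans, homOf_tensor, homOf_refl] at h'
      exact h')

instance : SymmetricCategory (MPlus M) where
  braiding P Q := isoOf (arrBraid P.arrow Q.arrow)
  braiding_naturality_right := by
    rintro P _ _ ⟨q⟩
    exact Quotient.sound (PlusRel.braid_naturality (PlusHom.id P.arrow) q)
  braiding_naturality_left := by
    rintro _ _ ⟨p⟩ Q
    exact Quotient.sound (PlusRel.braid_naturality p (PlusHom.id Q.arrow))
  hexagon_forward P Q R := by
    have h : arrAssoc P.arrow Q.arrow R.arrow ≪≫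
        arrBraid P.arrow (arrTensor Q.arrow R.arrow) ≪≫ arrAssoc Q.arrow R.arrow P.arrow =
        arrTensorIso (arrBraid P.arrow Q.arrow) (Iso.refl R.arrow) ≪≫
          arrAssoc Q.arrow P.arrow R.arrow ≪≫
            arrTensorIso (Iso.refl Q.arrow) (arrBraid P.arrow R.arrow) := by
      have key (X Y Z : M) : (α_ X Y Z).hom ≫ (β_ X (Y ⊗ Z)).hom ≫ (α_ Y Z X).hom =
          ((β_ X Y).hom ⊗ₘ 𝟙 Z) ≫ (α_ Y X Z).hom ≫ (𝟙 Y ⊗ₘ (β_ X Z).hom) := by simp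
      exact Iso.ext (Arrow.hom_ext _ _ (key _ _ _) (key _ _ _))
    have h' := congrArg homOf h
    simp only [homOf_trans, homOf_tensor, homOf_refl] at h'
    exact h'
  hexagon_reverse P Q R := by
    have h : (arrAssoc P.arrow Q.arrow R.arrow).symm ≪≫
        arrBraid (arrTensor P.arrow Q.arrow) R.arrow ≪≫
          (arrAssoc R.arrow P.arrow Q.arrow).symm =
        arrTensorIso (Iso.refl P.arrow) (arrBraid Q.arrow R.arrow) ≪≫
          (arrAssoc P.arrow R.arrow Q.arrow).symm ≪≫
            arrTensorIso (arrBraid P.arrow R.arrow) (Iso.refl Q.arrow) := by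
      have key (X Y Z : M) : (α_ X Y Z).inv ≫ (β_ (X ⊗ Y) Z).hom ≫ (α_ Z X Y).inv =
          (𝟙 X ⊗ₘ (β_ Y Z).hom) ≫ (α_ X Z Y).inv ≫ ((β_ X Z).hom ⊗ₘ 𝟙 Y) := by simp
      exact Iso.ext (Arrow.hom_ext _ _ (key _ _ _) (key _ _ _))
    have h' := congrArg homOf h
    simp only [homOf_trans, homOf_tensor, homOf_refl] at h'
    exact h'
  symmetry P Q := by
    have h : arrBraid P.arrow Q.arrow ≪≫ arrBraid Q.arrow P.arrow = Iso.refl _ := by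
      exact Iso.ext (Arrow.hom_ext _ _ (SymmetricCategory.symmetry _ _)
        (SymmetricCategory.symmetry _ _))
    have h' := congrArg homOf h
    simp only [homOf_trans, homOf_refl] at h'
    exact h'

end MPlus

end Plus

end PlusConstruction

/-! The statement on isomorphisms rests on the fact that no relation of `M⁺` equates a formal
morphism containing a `γ̄` with one that contains none. Evaluation in `Iso(M ↓ M)` with an absorbing
element for `γ̄` therefore descends to `M⁺` (`PlusRel.toIso?_eq`). It is a left inverse of the
canonical map on morphisms, which gives injectivity. If `p` is invertible with inverse `q`, the
composite of `p` and `q` has the value of an identity, so `p` contains no `γ̄`; functoriality and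
compatibility with `⊗` then bring `p` back to a single morphism of `Iso(M ↓ M)`
(`PlusHom.eq_homOf_of_toIso?_eq_some`).

For the equivalence, reading `⊠` as `⊗` and `μ`, `ε` as identities turns every relation of
`M^{loc+}` into one that holds in `M⁺` (`LocRel.value_eq`), so this reading is a strict symmetric
monoidal functor. In the other direction, `⊗` is sent to the conjugate of `⊠` by `μ`, and `γ̄` to
`γ` preceded by `μ⁻¹`. This respects the relations because the compatibilities of `μ` and `ε`, once
these are invertible, express the constraints of `Iso(M ↓ M)` through those of `⊠`
(`PlusRel.toLoc_eq`).

Every word is isomorphic to a one-letter word by a composite of `μ` and `ε`. This isomorphism is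
natural (`toLetter_naturality`), which gives faithfulness. It becomes an identity in `M⁺`, which
together with `toMPlus_map_toLoc` gives fullness. One-letter words already reach every object. -/

namespace PlusConstruction

/-! ### The isomorphisms of `M⁺`. -/

namespace MPlus

theorem arrow_iso_ext {C : Type u} [Category.{v} C] {A B : Arrow C} {e f : A ≅ B}
    (hl : e.hom.left = f.hom.left) (hr : e.hom.right = f.hom.right) : e = f :=
  Iso.ext (Arrow.hom_ext _ _ hl hr)

variable {M : Type u} [Category.{v} M] [MonoidalCategory M]

/-- The value of a formal morphism in the groupoid `Iso(M ↓ M)` with an absorbing element adjoined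
to every hom-set, which is the value of all formal morphisms that involve a `γ̄`. -/
def PlusHom.toIso? : ∀ {A B : Arrow M}, PlusHom A B → Option (A ≅ B)
  | _, _, .comp p q => p.toIso?.bind fun e => q.toIso?.map fun f => e ≪≫ f
  | _, _, .tensor p q => p.toIso?.bind fun e => q.toIso?.map fun f => arrTensorIso e f
  | _, _, .iso e => some e
  | _, _, .gamma _ _ => none

variable [SymmetricCategory M]

theorem PlusRel.toIso?_eq {A B : Arrow M} {p q : PlusHom A B} (h : PlusRel p q) :
    p.toIso? = q.toIso? := by
  induction h with
  | refl => rfl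
  | symm _ ih => exact ih.symm
  | trans _ _ ih ih' => exact ih.trans ih'
  | comp_congr _ _ ih ih' => simp only [PlusHom.toIso?, ih, ih']
  | tensor_congr _ _ ih ih' => simp only [PlusHom.toIso?, ih, ih']
  | id_comp p => cases hp : p.toIso? <;> simp [PlusHom.toIso?, PlusHom.id, hp]
  | comp_id p => cases hp : p.toIso? <;> simp [PlusHom.toIso?, PlusHom.id, hp]
  | assoc p q r =>
    cases hp : p.toIso? <;> cases hq : q.toIso? <;> cases hr : r.toIso? <;>
      simp [PlusHom.toIso?, hp, hq, hr]
  | tensor_comp p q p' q' =>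
    cases hp : p.toIso? <;> cases hq : q.toIso? <;> cases hp' : p'.toIso? <;>
      cases hq' : q'.toIso? <;> simp only [PlusHom.toIso?, hp, hq, hp', hq', Option.bind_none,
        Option.bind_some, Option.map_none, Option.map_some]
    -- Only the case without any `γ̄` is left: an equality of squares, checked on sources and on
    -- targets in `M`.
    exact congrArg some (arrow_iso_ext (tensorHom_comp_tensorHom _ _ _ _)
      (tensorHom_comp_tensorHom _ _ _ _))
  | assoc_naturality p q r =>
    cases hp : p.toIso? <;> cases hq : q.toIso? <;> cases hr : r.toIso? <;>
      simp only [PlusHom.toIso?, hp, hq, hr, Option.bind_none,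
        Option.bind_some, Option.map_none, Option.map_some]
    exact congrArg some (arrow_iso_ext (associator_naturality _ _ _)
      (associator_naturality _ _ _))
  | left_naturality p =>
    cases hp : p.toIso? <;>
      simp only [PlusHom.toIso?, PlusHom.id, hp, Option.bind_none,
        Option.bind_some, Option.map_none, Option.map_some]
    have key {X Y : M} (f : X ⟶ Y) : (𝟙 (𝟙_ M) ⊗ₘ f) ≫ (λ_ Y).hom = (λ_ X).hom ≫ f := by simp
    exact congrArg some (arrow_iso_ext (key _) (key _))
  | right_naturality p =>
    cases hp : p.toIso? <;>
      simp only [PlusHom.toIso?, PlusHom.id, hp, Option.bind_none,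
        Option.bind_some, Option.map_none, Option.map_some]
    have key {X Y : M} (f : X ⟶ Y) : (f ⊗ₘ 𝟙 (𝟙_ M)) ≫ (ρ_ Y).hom = (ρ_ X).hom ≫ f := by simp
    exact congrArg some (arrow_iso_ext (key _) (key _))
  | braid_naturality p q =>
    cases hp : p.toIso? <;> cases hq : q.toIso? <;>
      simp only [PlusHom.toIso?, hp, hq, Option.bind_none,
        Option.bind_some, Option.map_none, Option.map_some]
    exact congrArg some (arrow_iso_ext (BraidedCategory.braiding_naturality _ _)
      (BraidedCategory.braiding_naturality _ _))
  | iso_trans => rfl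
  | iso_tensor => rfl
  -- In the four relations for `γ̄`, each side contains a `γ̄`, so both values are `none`.
  | gamma_inner => rfl
  | gamma_outer => rfl
  | gamma_assoc => rfl
  | interchange => rfl

/-- A formal morphism with a value is built from squares by composition and `⊗` alone, and `homOf`
is compatible with both operations. -/
theorem PlusHom.eq_homOf_of_toIso?_eq_some {A B : Arrow M} (p : PlusHom A B) {e : A ≅ B}
    (h : p.toIso? = some e) : (⟦p⟧ : MPlus.mk A ⟶ MPlus.mk B) = homOf e := by
  induction p with
  | comp p q ihp ihq =>
    simp only [PlusHom.toIso?, Option.bind_eq_some_iff, Option.map_eq_some_iff] at h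
    obtain ⟨e, he, f, hf, rfl⟩ := h
    rw [homOf_trans, ← ihp he, ← ihq hf]
    rfl
  | tensor p q ihp ihq =>
    simp only [PlusHom.toIso?, Option.bind_eq_some_iff, Option.map_eq_some_iff] at h
    obtain ⟨e, he, f, hf, rfl⟩ := h
    rw [homOf_tensor, ← ihp he, ← ihq hf]
    rfl
  | iso f => rw [Option.some.inj h.symm]; rfl
  | gamma => cases h

theorem homOf_injective {A B : Arrow M} : Function.Injective (homOf : (A ≅ B) → _) :=
  fun _ _ h => Option.some.inj (PlusRel.toIso?_eq (Quotient.exact h))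

theorem isoOf_bijective (A B : Arrow M) :
    Function.Bijective (isoOf : (A ≅ B) → (MPlus.mk A ≅ MPlus.mk B)) := by
  refine ⟨fun e f h => homOf_injective (congrArg Iso.hom h), fun i => ?_⟩
  obtain ⟨p, hp⟩ := Quotient.exists_rep i.hom
  obtain ⟨q, hq⟩ := Quotient.exists_rep i.inv
  have h : (⟦p.comp q⟧ : MPlus.mk A ⟶ MPlus.mk A) = ⟦PlusHom.id A⟧ := by
    refine Eq.trans ?_ i.hom_inv_id
    rw [← hp, ← hq]
    rfl
  -- A composite has a value only if its first factor has one. This is the only use of the inverse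
  -- `q`.
  have h' : (p.comp q).toIso? = some (Iso.refl A) := PlusRel.toIso?_eq (Quotient.exact h)
  simp only [PlusHom.toIso?, Option.bind_eq_some_iff] at h'
  obtain ⟨e, he, -⟩ := h'
  exact ⟨e, Iso.ext ((p.eq_homOf_of_toIso?_eq_some he).symm.trans hp)⟩

end MPlus

/-! ### The symmetric monoidal functor from `M^{loc+}` to `M⁺`. -/

namespace MLocPlus

variable {M : Type u} [Category.{v} M] [MonoidalCategory M] [SymmetricCategory M]

/-- The value in `M⁺` of a `⊠`-word, obtained by reading `⊠` as `⊗`. -/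
def value : MLocPlus M → MPlus M
  | of A => ⟨A⟩
  | unit => 𝟙_ (MPlus M)
  | tensor P Q => P.value ⊗ Q.value

/-- The morphism of `M⁺` obtained from a formal morphism of `M^{loc+}` by reading `⊠` as `⊗`, with
`μ` and `ε` read as identities. -/
def LocHom.value : ∀ {P Q : MLocPlus M}, LocHom P Q → (P.value ⟶ Q.value)
  | _, _, .id P => 𝟙 P.value
  | _, _, .comp p q => p.value ≫ q.value
  | _, _, .tensor p q => p.value ⊗ₘ q.value
  | _, _, .assocHom P Q R => (α_ P.value Q.value R.value).hom
  | _, _, .assocInv P Q R => (α_ P.value Q.value R.value).inv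
  | _, _, .leftHom P => (λ_ P.value).hom
  | _, _, .leftInv P => (λ_ P.value).inv
  | _, _, .rightHom P => (ρ_ P.value).hom
  | _, _, .rightInv P => (ρ_ P.value).inv
  | _, _, .braid P Q => (β_ P.value Q.value).hom
  | _, _, .iso e => MPlus.homOf e
  | _, _, .gamma g f => (⟦.gamma g f⟧ : MPlus.mk _ ⟶ MPlus.mk _)
  | _, _, .mu A B => 𝟙 (MPlus.mk (arrTensor A B))
  | _, _, .muInv A B => 𝟙 (MPlus.mk (arrTensor A B))
  | _, _, .eps => 𝟙 (MPlus.mk (arrUnit M))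
  | _, _, .epsInv => 𝟙 (MPlus.mk (arrUnit M))

/-- Needed for interchange, where `M⁺` uses the exchange of `Iso(M ↓ M)` and `M^{loc+}` the one
built from the constraints of `⊠`. The two differ only in the bracketing of composites. -/
theorem homOf_arrMiddle (A B C D : Arrow M) :
    MPlus.homOf (arrMiddle A B C D) =
      (LocHom.middle (of A) (of B) (of C) (of D)).value := by
  simp only [arrMiddle, MPlus.homOf_trans, MPlus.homOf_tensor]
  rw [← Category.assoc]
  rw [← Category.assoc]
  rfl

/-- Each relation becomes an axiom of symmetric monoidal categories, a property of `homOf`, a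
relation for `γ̄`, or, for most of those on `μ` and `ε`, an equality between composites with
identities. -/
theorem LocRel.value_eq {P Q : MLocPlus M} {p q : LocHom P Q} (h : LocRel p q) :
    p.value = q.value := by
  induction h with
  | refl => rfl
  | symm _ ih => exact ih.symm
  | trans _ _ ih ih' => exact ih.trans ih'
  | comp_congr _ _ ih ih' => exact congrArg₂ _ ih ih'
  | tensor_congr _ _ ih ih' => exact congrArg₂ _ ih ih'
  | id_comp p => exact Category.id_comp _
  | comp_id p => exact Category.comp_id _
  | assoc p q r => exact Category.assoc _ _ _
  | tensor_id => exact id_tensorHom_id _ _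
  | tensor_comp p q p' q' => exact tensorHom_comp_tensorHom _ _ _ _
  | assoc_hom_inv => exact Iso.hom_inv_id _
  | assoc_inv_hom => exact Iso.inv_hom_id _
  | assoc_naturality p q r => exact associator_naturality _ _ _
  | left_hom_inv => exact Iso.hom_inv_id _
  | left_inv_hom => exact Iso.inv_hom_id _
  | left_naturality p =>
    exact (congrArg (· ≫ _) (id_tensorHom _ _)).trans (leftUnitor_naturality _)
  | right_hom_inv => exact Iso.hom_inv_id _
  | right_inv_hom => exact Iso.inv_hom_id _
  | right_naturality p =>
    exact (congrArg (· ≫ _) (tensorHom_id _ _)).trans (rightUnitor_naturality _)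
  | pentagon P Q R S => exact MonoidalCategory.pentagon P.value Q.value R.value S.value
  | triangle P Q => exact MonoidalCategory.triangle P.value Q.value
  | braid_naturality p q => exact BraidedCategory.braiding_naturality _ _
  | braid_braid => exact SymmetricCategory.symmetry _ _
  | hexagon P Q R => exact BraidedCategory.hexagon_forward P.value Q.value R.value
  | iso_refl => rfl
  | iso_trans e f => exact MPlus.homOf_trans e f
  | gamma_inner g f σ => exact Quotient.sound (MPlus.PlusRel.gamma_inner g f σ)
  | gamma_outer g f σ τ => exact Quotient.sound (MPlus.PlusRel.gamma_outer g f σ τ)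
  | gamma_assoc h g f => exact Quotient.sound (MPlus.PlusRel.gamma_assoc h g f)
  | mu_equivariant e f =>
    refine (Category.comp_id _).trans ((Category.id_comp _).trans ?_).symm
    exact MPlus.homOf_tensor e f
  | mu_assoc A B C =>
    refine (congrArg₂ (· ≫ ·) (id_tensorHom_id (MPlus.mk (arrTensor A B)) (MPlus.mk C))
      (Category.id_comp _)).trans ?_
    refine ((Category.id_comp _).trans ?_)
    refine ((congrArg (_ ≫ ·) ((Category.comp_id _).trans
      (id_tensorHom_id (MPlus.mk A) (MPlus.mk (arrTensor B C))))).trans (Category.comp_id _)).symm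
  | mu_left_unit A =>
    exact (congrArg₂ (· ≫ ·) (id_tensorHom_id (MPlus.mk (arrUnit M)) (MPlus.mk A))
      (Category.id_comp _)).trans (Category.id_comp _)
  | mu_right_unit A =>
    exact (congrArg₂ (· ≫ ·) (id_tensorHom_id (MPlus.mk A) (MPlus.mk (arrUnit M)))
      (Category.id_comp _)).trans (Category.id_comp _)
  | interchange g g' f f' =>
    refine (congrArg (· ≫ _) (id_tensorHom_id (MPlus.mk (arrTensor (Arrow.mk g) (Arrow.mk g')))
      (MPlus.mk (arrTensor (Arrow.mk f) (Arrow.mk f'))))).trans ((Category.id_comp _).trans ?_)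
    refine Eq.trans ?_ (congrArg₂ (· ≫ ·) (homOf_arrMiddle _ _ _ _) (Category.comp_id _).symm)
    exact Quotient.sound (MPlus.PlusRel.interchange g g' f f')
  | mu_commutator A B => exact (Category.id_comp _).trans (Category.comp_id _).symm
  | mu_hom_inv => exact Category.id_comp _
  | mu_inv_hom => exact Category.id_comp _
  | eps_hom_inv => exact Category.id_comp _
  | eps_inv_hom => exact Category.id_comp _

/-- The functor `M^{loc+} ⥤ M⁺`. -/
def toMPlus : MLocPlus M ⥤ MPlus M where
  obj := value
  map := Quotient.lift LocHom.value fun _ _ => LocRel.value_eq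
  map_id _ := rfl
  map_comp := by
    rintro _ _ _ ⟨p⟩ ⟨q⟩
    rfl

/-- The functor `M^{loc+} ⥤ M⁺` is strict monoidal. -/
def toMPlusCoreMonoidal : (toMPlus (M := M)).CoreMonoidal where
  -- The values of the empty word and of a `⊠`-product are the unit and the `⊗`-product by
  -- definition.
  εIso := Iso.refl _
  μIso _ _ := Iso.refl _
  μIso_hom_natural_left := by
    rintro _ _ ⟨p⟩ _
    exact (Category.comp_id _).trans ((Category.id_comp _).trans (tensorHom_id _ _)).symm
  μIso_hom_natural_right := by
    rintro _ _ _ ⟨p⟩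
    exact (Category.comp_id _).trans ((Category.id_comp _).trans (id_tensorHom _ _)).symm
  associativity P Q R := by
    simp only [Iso.refl_hom]
    erw [id_whiskerRight, whiskerLeft_id, Category.id_comp, Category.id_comp, Category.comp_id,
      Category.comp_id]
    rfl
  left_unitality P := by
    simp only [Iso.refl_hom]
    erw [id_whiskerRight, Category.id_comp, Category.id_comp]
    rfl
  right_unitality P := by
    simp only [Iso.refl_hom]
    erw [whiskerLeft_id, Category.id_comp, Category.id_comp]
    rfl

instance : (toMPlus (M := M)).Monoidal := toMPlusCoreMonoidal.toMonoidal

instance : (toMPlus (M := M)).Braided where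
  braided _ _ := (Category.id_comp _).trans (Category.comp_id _).symm

/-! ### The structure of `Iso(M ↓ M)` expressed in `M^{loc+}` through `⊠`, `μ` and `ε`. -/

/-- The morphism of `M^{loc+}` given by a morphism of `Iso(M ↓ M)`. -/
def isoHom {A B : Arrow M} (e : A ≅ B) : of A ⟶ of B := ⟦.iso e⟧

/-- The morphism `γ_{g,f}` of `M^{loc+}`. -/
def gammaHom {X Y Z : M} (g : Y ⟶ Z) (f : X ⟶ Y) :
    of (Arrow.mk g) ⊗ of (Arrow.mk f) ⟶ of (Arrow.mk (f ≫ g)) := ⟦.gamma g f⟧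

/-- The isomorphism `μ_{A,B}` of `M^{loc+}`. -/
def muIso (A B : Arrow M) : of A ⊗ of B ≅ of (arrTensor A B) :=
  ⟨⟦.mu A B⟧, ⟦.muInv A B⟧, Quotient.sound (.mu_hom_inv A B), Quotient.sound (.mu_inv_hom A B)⟩

variable (M) in
/-- The isomorphism `ε` of `M^{loc+}`. -/
def epsIso : 𝟙_ (MLocPlus M) ≅ of (arrUnit M) :=
  ⟨⟦.eps⟧, ⟦.epsInv⟧, Quotient.sound .eps_hom_inv, Quotient.sound .eps_inv_hom⟩

theorem isoHom_refl (A : Arrow M) : isoHom (Iso.refl A) = 𝟙 (of A) :=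
  Quotient.sound (.iso_refl A)

theorem isoHom_trans {A B C : Arrow M} (e : A ≅ B) (f : B ≅ C) :
    isoHom (e ≪≫ f) = isoHom e ≫ isoHom f :=
  Quotient.sound (.iso_trans e f)

theorem isoHom_comp_symm {A B : Arrow M} (e : A ≅ B) : isoHom e ≫ isoHom e.symm = 𝟙 (of A) := by
  rw [← isoHom_trans, Iso.self_symm_id, isoHom_refl]

theorem isoHom_arrTensorIso {A A' B B' : Arrow M} (e : A ≅ A') (f : B ≅ B') :
    isoHom (arrTensorIso e f) =
      (muIso A B).inv ≫ (isoHom e ⊗ₘ isoHom f) ≫ (muIso A' B').hom :=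
  (Iso.eq_inv_comp _).2 (Quotient.sound (LocRel.mu_equivariant e f).symm)

theorem mu_mu_isoHom_arrAssoc (A B C : Arrow M) :
    (muIso A B).hom ▷ of C ≫ (muIso (arrTensor A B) C).hom ≫ isoHom (arrAssoc A B C) =
      (α_ (of A) (of B) (of C)).hom ≫ of A ◁ (muIso B C).hom ≫ (muIso A (arrTensor B C)).hom :=
  Quotient.sound (.mu_assoc A B C)

theorem eps_mu_isoHom_arrLeftUnitor (A : Arrow M) :
    (epsIso M).hom ▷ of A ≫ (muIso (arrUnit M) A).hom ≫ isoHom (arrLeftUnitor A) =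
      (λ_ (of A)).hom :=
  Quotient.sound (.mu_left_unit A)

theorem eps_mu_isoHom_arrRightUnitor (A : Arrow M) :
    of A ◁ (epsIso M).hom ≫ (muIso A (arrUnit M)).hom ≫ isoHom (arrRightUnitor A) =
      (ρ_ (of A)).hom :=
  Quotient.sound (.mu_right_unit A)

theorem mu_isoHom_arrBraid (A B : Arrow M) :
    (muIso A B).hom ≫ isoHom (arrBraid A B) = (β_ (of A) (of B)).hom ≫ (muIso B A).hom :=
  Quotient.sound (.mu_commutator A B)

/-- This solves the associativity relation of `μ` for the associator of `⊗`, which is possible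
because `μ` is invertible; the unitors and the braiding are treated likewise. -/
theorem isoHom_arrAssoc (A B C : Arrow M) :
    isoHom (arrAssoc A B C) =
      (muIso (arrTensor A B) C).inv ≫ (muIso A B).inv ▷ of C ≫ (α_ (of A) (of B) (of C)).hom ≫
        of A ◁ (muIso B C).hom ≫ (muIso A (arrTensor B C)).hom := by
  rw [← mu_mu_isoHom_arrAssoc, inv_hom_whiskerRight_assoc, Iso.inv_hom_id_assoc]

theorem isoHom_arrAssoc_symm (A B C : Arrow M) :
    isoHom (arrAssoc A B C).symm =
      (muIso A (arrTensor B C)).inv ≫ of A ◁ (muIso B C).inv ≫ (α_ (of A) (of B) (of C)).inv ≫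
        (muIso A B).hom ▷ of C ≫ (muIso (arrTensor A B) C).hom := by
  have h := isoHom_comp_symm (arrAssoc A B C)
  rw [isoHom_arrAssoc] at h
  simp only [Category.assoc] at h
  rw [Iso.inv_comp_eq, Category.comp_id] at h
  -- The prefix is the inverse of everything that stands before `isoHom (arrAssoc A B C).symm` in
  -- `h`, so it isolates that morphism.
  have h2 := congrArg (fun t => (muIso A (arrTensor B C)).inv ≫ of A ◁ (muIso B C).inv ≫
    (α_ (of A) (of B) (of C)).inv ≫ (muIso A B).hom ▷ of C ≫ t) h
  simpa using h2

theorem isoHom_arrLeftUnitor (A : Arrow M) :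
    isoHom (arrLeftUnitor A) =
      (muIso (arrUnit M) A).inv ≫ (epsIso M).inv ▷ of A ≫ (λ_ (of A)).hom := by
  rw [← eps_mu_isoHom_arrLeftUnitor, inv_hom_whiskerRight_assoc, Iso.inv_hom_id_assoc]

theorem isoHom_arrRightUnitor (A : Arrow M) :
    isoHom (arrRightUnitor A) =
      (muIso A (arrUnit M)).inv ≫ of A ◁ (epsIso M).inv ≫ (ρ_ (of A)).hom := by
  rw [← eps_mu_isoHom_arrRightUnitor, whiskerLeft_inv_hom_assoc, Iso.inv_hom_id_assoc]

theorem isoHom_arrBraid (A B : Arrow M) :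
    isoHom (arrBraid A B) = (muIso A B).inv ≫ (β_ (of A) (of B)).hom ≫ (muIso B A).hom :=
  (Iso.eq_inv_comp _).2 (mu_isoHom_arrBraid A B)

/-- The exchange of the two middle factors of a four-fold `⊠`-product. -/
def middleHom (P Q R S : MLocPlus M) : (P ⊗ Q) ⊗ (R ⊗ S) ⟶ (P ⊗ R) ⊗ (Q ⊗ S) :=
  (α_ P Q (R ⊗ S)).hom ≫ P ◁ ((α_ Q R S).inv ≫ (β_ Q R).hom ▷ S ≫ (α_ R Q S).hom) ≫
    (α_ P R (Q ⊗ S)).inv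

theorem middle_eq_middleHom (P Q R S : MLocPlus M) :
    (⟦LocHom.middle P Q R S⟧ : (P ⊗ Q) ⊗ (R ⊗ S) ⟶ (P ⊗ R) ⊗ (Q ⊗ S)) = middleHom P Q R S := by
  rw [middleHom, ← Category.assoc (α_ Q R S).inv, ← Category.assoc (α_ P Q (R ⊗ S)).hom]
  rfl

theorem gamma_interchange {X Y Z X' Y' Z' : M} (g : Y ⟶ Z) (g' : Y' ⟶ Z') (f : X ⟶ Y)
    (f' : X' ⟶ Y') :
    ((muIso (Arrow.mk g) (Arrow.mk g')).hom ⊗ₘ (muIso (Arrow.mk f) (Arrow.mk f')).hom) ≫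
        gammaHom (g ⊗ₘ g') (f ⊗ₘ f') ≫ isoHom (arrInterchange g g' f f') =
      middleHom (of (Arrow.mk g)) (of (Arrow.mk g')) (of (Arrow.mk f)) (of (Arrow.mk f')) ≫
        (gammaHom g f ⊗ₘ gammaHom g' f') ≫ (muIso (Arrow.mk (f ≫ g)) (Arrow.mk (f' ≫ g'))).hom :=
  (Quotient.sound (LocRel.interchange g g' f f')).trans
    (congrArg (· ≫ (gammaHom g f ⊗ₘ gammaHom g' f') ≫ (muIso (Arrow.mk (f ≫ g)) _).hom)
      (middle_eq_middleHom _ _ _ _))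

theorem isoHom_arrMiddle (A B C D : Arrow M) :
    isoHom (arrMiddle A B C D) =
      (muIso (arrTensor A B) (arrTensor C D)).inv ≫ ((muIso A B).inv ⊗ₘ (muIso C D).inv) ≫
        middleHom (of A) (of B) (of C) (of D) ≫ ((muIso A C).hom ⊗ₘ (muIso B D).hom) ≫
          (muIso (arrTensor A C) (arrTensor B D)).hom := by
  -- On the left side `μ` on `B`, `D` is applied before `μ` on `A`, `C`, the opposite of the order
  -- that `tensorHom_def` would produce for this product.
  rw [MonoidalCategory.tensorHom_def' (muIso A C).hom]
  simp [arrMiddle, isoHom_trans, isoHom_arrTensorIso, isoHom_arrAssoc, isoHom_arrAssoc_symm,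
    isoHom_arrBraid, isoHom_refl, middleHom, MonoidalCategory.tensorHom_def]

end MLocPlus

/-! ### From `M⁺` back to one-letter words of `M^{loc+}`. -/

namespace MPlus

open MLocPlus

variable {M : Type u} [Category.{v} M] [MonoidalCategory M] [SymmetricCategory M]

/-- The morphism of `M^{loc+}` between one-letter words obtained from a formal morphism of `M⁺` by
conjugating `⊗` with `μ`. -/
def PlusHom.toLoc : ∀ {A B : Arrow M}, PlusHom A B → (of A ⟶ of B)
  | _, _, .comp p q => p.toLoc ≫ q.toLoc
  | _, _, .tensor p q => (muIso _ _).inv ≫ (p.toLoc ⊗ₘ q.toLoc) ≫ (muIso _ _).hom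
  | _, _, .iso e => isoHom e
  | _, _, .gamma g f => (muIso _ _).inv ≫ gammaHom g f

theorem PlusHom.toLoc_id (A : Arrow M) : (PlusHom.id A).toLoc = 𝟙 (of A) := isoHom_refl A

/-- Interior pairs of `μ` and `μ⁻¹` cancel, and what remains is the corresponding relation for `⊠`,
up to outer factors `μ` and `μ⁻¹` common to both sides. -/
theorem PlusRel.toLoc_eq {A B : Arrow M} {p q : PlusHom A B} (h : PlusRel p q) :
    p.toLoc = q.toLoc := by
  induction h with
  | refl => rfl
  | symm _ ih => exact ih.symm
  | trans _ _ ih ih' => exact ih.trans ih'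
  | comp_congr _ _ ih ih' => exact congrArg₂ _ ih ih'
  | tensor_congr _ _ ih ih' => simp only [PlusHom.toLoc, ih, ih']
  | id_comp p => simp only [PlusHom.toLoc, PlusHom.toLoc_id, Category.id_comp]
  | comp_id p => simp only [PlusHom.toLoc, PlusHom.toLoc_id, Category.comp_id]
  | assoc p q r => exact Category.assoc _ _ _
  | tensor_comp p q p' q' =>
    simp only [PlusHom.toLoc, Category.assoc, Iso.hom_inv_id_assoc, tensorHom_comp_tensorHom_assoc]
  | assoc_naturality p q r =>
    -- `hl` and `hr` move the remaining `μ⁻¹` and `μ` out of a tensor factor while keeping the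
    -- threefold product of `p`, `q`, `r` whole, so that naturality of the associator applies.
    have hl {P P' Q Q' R : MLocPlus M} (a : P ⟶ P') (b : P' ⟶ Q) (r : Q' ⟶ R) :
        (a ≫ b) ⊗ₘ r = a ▷ Q' ≫ (b ⊗ₘ r) := by simp [MonoidalCategory.tensorHom_def]
    have hr {P P' Q Q' R : MLocPlus M} (a : P ⟶ P') (b : P' ⟶ Q) (r : Q' ⟶ R) :
        r ⊗ₘ (a ≫ b) = (r ⊗ₘ a) ≫ R ◁ b := by simp [MonoidalCategory.tensorHom_def]
    simp only [PlusHom.toLoc, isoHom_arrAssoc, ← tensorHom_id, ← id_tensorHom, Category.assoc,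
      Iso.hom_inv_id_assoc, tensorHom_comp_tensorHom_assoc, Iso.hom_inv_id, Category.comp_id,
      Category.id_comp]
    rw [hl, hr]
    simp only [Category.assoc, associator_naturality_assoc, id_tensorHom, tensorHom_id]
  | left_naturality p =>
    simp only [PlusHom.toLoc, PlusHom.toLoc_id, isoHom_arrLeftUnitor, id_tensorHom, Category.assoc,
      Iso.hom_inv_id_assoc]
    -- The exchange moves `ε⁻¹` past `p`, after which the unitor of `⊠` is natural.
    rw [whisker_exchange_assoc, leftUnitor_naturality]
  | right_naturality p =>
    simp only [PlusHom.toLoc, PlusHom.toLoc_id, isoHom_arrRightUnitor, tensorHom_id, Category.assoc,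
      Iso.hom_inv_id_assoc]
    rw [← whisker_exchange_assoc, rightUnitor_naturality]
  | braid_naturality p q => simp [PlusHom.toLoc, isoHom_arrBraid]
  | iso_trans e f => exact isoHom_trans e f
  | iso_tensor e f => exact isoHom_arrTensorIso e f
  | gamma_inner g f σ =>
    simp only [PlusHom.toLoc, Category.assoc, Iso.hom_inv_id_assoc]
    exact congrArg (_ ≫ ·) (Quotient.sound (LocRel.gamma_inner g f σ))
  | gamma_outer g f σ τ =>
    simp only [PlusHom.toLoc, Category.assoc, Iso.hom_inv_id_assoc]
    exact congrArg (_ ≫ ·) (Quotient.sound (LocRel.gamma_outer g f σ τ))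
  | gamma_assoc h g f =>
    have key : gammaHom h g ▷ of (Arrow.mk f) ≫ gammaHom (g ≫ h) f =
      (α_ _ _ _).hom ≫ of (Arrow.mk h) ◁ gammaHom g f ≫ gammaHom h (f ≫ g) ≫
        isoHom (cellOfEq (Category.assoc f g h)) := Quotient.sound (LocRel.gamma_assoc h g f)
    simp [PlusHom.toLoc, PlusHom.toLoc_id, isoHom_arrAssoc, key]
  | interchange g g' f f' =>
    -- The inner `μ⁻¹` cancel the `μ` in front of `γ`; on the other side, both layers are the
    -- beginning of the expression for `arrMiddle`.
    have key := congrArg ((muIso _ _).inv ≫ ((muIso _ _).inv ⊗ₘ (muIso _ _).inv) ≫ ·)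
      (gamma_interchange g g' f f')
    simp only [tensorHom_comp_tensorHom_assoc, Iso.inv_hom_id, id_tensorHom_id,
      Category.id_comp] at key
    refine (Category.assoc _ _ _).trans (key.trans ?_)
    refine Eq.trans ?_ (congrArg (· ≫ _) (isoHom_arrMiddle _ _ _ _).symm)
    simp [PlusHom.toLoc]

end MPlus

/-! ### The equivalence of `M^{loc+}` and `M⁺`. -/

namespace MLocPlus

variable {M : Type u} [Category.{v} M] [MonoidalCategory M] [SymmetricCategory M]

variable (M) in
/-- The functor `M⁺ ⥤ M^{loc+}` that sends a morphism of `M` to the word with that one letter. -/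
def ofMPlus : MPlus M ⥤ MLocPlus M where
  obj A := of A.arrow
  map := Quotient.lift MPlus.PlusHom.toLoc fun _ _ => MPlus.PlusRel.toLoc_eq
  map_id A := isoHom_refl A.arrow
  map_comp := by
    rintro _ _ _ ⟨p⟩ ⟨q⟩
    rfl

theorem toMPlus_map_tensorHom {P P' Q Q' : MLocPlus M} (p : P ⟶ P') (q : Q ⟶ Q') :
    toMPlus.map (p ⊗ₘ q) = toMPlus.map p ⊗ₘ toMPlus.map q := by
  obtain ⟨p, rfl⟩ := Quotient.exists_rep p
  obtain ⟨q, rfl⟩ := Quotient.exists_rep q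
  rfl

theorem ofMPlus_map_tensorHom {A A' B B' : MPlus M} (p : A ⟶ A') (q : B ⟶ B') :
    (ofMPlus M).map (p ⊗ₘ q) =
      (muIso A.arrow B.arrow).inv ≫ ((ofMPlus M).map p ⊗ₘ (ofMPlus M).map q) ≫
        (muIso A'.arrow B'.arrow).hom := by
  obtain ⟨p, rfl⟩ := Quotient.exists_rep p
  obtain ⟨q, rfl⟩ := Quotient.exists_rep q
  rfl

/-- The conjugating `μ` become identities in `M⁺`. This supplies the preimages for fullness. -/
theorem toMPlus_map_toLoc {A B : Arrow M} (p : MPlus.PlusHom A B) :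
    toMPlus.map p.toLoc = (⟦p⟧ : MPlus.mk A ⟶ MPlus.mk B) := by
  induction p with
  | comp p q ihp ihq =>
    exact (toMPlus.map_comp _ _).trans (congrArg₂ (· ≫ ·) ihp ihq)
  | tensor p q ihp ihq =>
    refine (toMPlus.map_comp _ _).trans ((Category.id_comp _).trans ?_)
    refine (toMPlus.map_comp _ _).trans ((Category.comp_id _).trans ?_)
    exact (toMPlus_map_tensorHom _ _).trans (congrArg₂ (· ⊗ₘ ·) ihp ihq)
  | iso e => rfl
  | gamma g f => exact (toMPlus.map_comp _ _).trans (Category.id_comp _)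

/-- The product of the letters of a `⊠`-word, as an isomorphism of `M^{loc+}` composed of `μ`
and `ε`. -/
def toLetter : ∀ P : MLocPlus M, P ≅ of P.value.arrow
  | of _ => Iso.refl _
  | unit => epsIso M
  | tensor P Q => (P.toLetter ⊗ᵢ Q.toLetter) ≪≫ muIso _ _

theorem toMPlus_map_toLetter (P : MLocPlus M) : toMPlus.map P.toLetter.hom = 𝟙 P.value := by
  induction P with
  | of A => rfl
  | unit => rfl
  | tensor P Q ihP ihQ =>
    refine (toMPlus.map_comp _ _).trans ((Category.comp_id _).trans ?_)
    refine (toMPlus_map_tensorHom _ _).trans ((congrArg₂ (· ⊗ₘ ·) ihP ihQ).trans ?_)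
    exact id_tensorHom_id _ _

/-- A naturality square passes to inverses, so the inverse associators and unitors need no
computation of their own. -/
theorem comp_toLetter_of_comp_eq_id {P Q : MLocPlus M} {p : P ⟶ Q} {q : Q ⟶ P}
    {a : of P.value.arrow ⟶ of Q.value.arrow} {b : of Q.value.arrow ⟶ of P.value.arrow}
    (h : p ≫ Q.toLetter.hom = P.toLetter.hom ≫ a) (hqp : q ≫ p = 𝟙 Q) (hab : a ≫ b = 𝟙 _) :
    q ≫ P.toLetter.hom = Q.toLetter.hom ≫ b := by
  calc q ≫ P.toLetter.hom = q ≫ (P.toLetter.hom ≫ a) ≫ b := by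
        rw [Category.assoc, hab, Category.comp_id]
    _ = (q ≫ p) ≫ Q.toLetter.hom ≫ b := by simp only [← h, Category.assoc]
    _ = _ := by rw [hqp, Category.id_comp]

/-- Naturality of the associator of `⊠` reduces the square to the letters `P.value`, `Q.value`,
`R.value`, where it is the associativity of `μ`. -/
theorem associator_toLetter (P Q R : MLocPlus M) :
    (α_ P Q R).hom ≫ (P.tensor (Q.tensor R)).toLetter.hom =
      ((P.tensor Q).tensor R).toLetter.hom ≫
        isoHom (arrAssoc P.value.arrow Q.value.arrow R.value.arrow) := by
  have h := mu_mu_isoHom_arrAssoc P.value.arrow Q.value.arrow R.value.arrow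
  have hl : ((P.tensor Q).tensor R).toLetter.hom =
    ((P.toLetter.hom ⊗ₘ Q.toLetter.hom) ⊗ₘ R.toLetter.hom) ≫
      (muIso P.value.arrow Q.value.arrow).hom ▷ of R.value.arrow ≫
        (muIso (arrTensor P.value.arrow Q.value.arrow) R.value.arrow).hom := by
    rw [← tensorHom_id, tensorHom_comp_tensorHom_assoc, Category.comp_id]
    rfl
  have hr : (P.tensor (Q.tensor R)).toLetter.hom =
    (P.toLetter.hom ⊗ₘ (Q.toLetter.hom ⊗ₘ R.toLetter.hom)) ≫
      of P.value.arrow ◁ (muIso Q.value.arrow R.value.arrow).hom ≫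
        (muIso P.value.arrow (arrTensor Q.value.arrow R.value.arrow)).hom := by
    rw [← id_tensorHom, tensorHom_comp_tensorHom_assoc, Category.comp_id]
    rfl
  refine (congrArg (_ ≫ ·) hr).trans (Eq.trans ?_ (congrArg (· ≫ _) hl).symm)
  refine (associator_naturality_assoc _ _ _ _).symm.trans ((congrArg (_ ≫ ·) h.symm).trans ?_)
  exact ((Category.assoc _ _ _).trans (congrArg (_ ≫ ·) (Category.assoc _ _ _))).symm

theorem leftUnitor_toLetter (P : MLocPlus M) :
    (λ_ P).hom ≫ P.toLetter.hom =
      (MLocPlus.unit.tensor P).toLetter.hom ≫ isoHom (arrLeftUnitor P.value.arrow) := by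
  have h : (MLocPlus.unit.tensor P).toLetter.hom = 𝟙_ (MLocPlus M) ◁ P.toLetter.hom ≫
      (epsIso M).hom ▷ of P.value.arrow ≫ (muIso (arrUnit M) P.value.arrow).hom := by
    rw [whisker_exchange_assoc, ← tensorHom_def_assoc]
    rfl
  rw [h, ← leftUnitor_naturality, ← eps_mu_isoHom_arrLeftUnitor]
  exact ((Category.assoc _ _ _).trans (congrArg (_ ≫ ·) (Category.assoc _ _ _))).symm

theorem rightUnitor_toLetter (P : MLocPlus M) :
    (ρ_ P).hom ≫ P.toLetter.hom =
      (P.tensor MLocPlus.unit).toLetter.hom ≫ isoHom (arrRightUnitor P.value.arrow) := by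
  have h : (P.tensor MLocPlus.unit).toLetter.hom = P.toLetter.hom ▷ 𝟙_ (MLocPlus M) ≫
      of P.value.arrow ◁ (epsIso M).hom ≫ (muIso P.value.arrow (arrUnit M)).hom := by
    rw [← tensorHom_def_assoc]
    rfl
  rw [h, ← rightUnitor_naturality, ← eps_mu_isoHom_arrRightUnitor]
  exact ((Category.assoc _ _ _).trans (congrArg (_ ≫ ·) (Category.assoc _ _ _))).symm

/-- Since `toLetter` follows the bracketing of words, it is enough to check generators. For a
constraint, the square combines its naturality with the compatibility of `μ` and `ε`. For `γ`, `μ`,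
`ε` and their inverses, `toLetter` is itself `μ`, `ε` or an identity, up to identity factors. -/
theorem toLetter_naturality {P Q : MLocPlus M} (p : P ⟶ Q) :
    p ≫ Q.toLetter.hom = P.toLetter.hom ≫ (ofMPlus M).map (toMPlus.map p) := by
  obtain ⟨p, rfl⟩ := Quotient.exists_rep p
  induction p with
  | id P => exact (Category.id_comp _).trans ((congrArg (_ ≫ ·) (isoHom_refl _)).trans
      (Category.comp_id _)).symm
  | @comp P Q R p q ihp ihq =>
    have h : ((⟦p⟧ : P ⟶ Q) ≫ (⟦q⟧ : Q ⟶ R)) ≫ R.toLetter.hom =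
        P.toLetter.hom ≫ (ofMPlus M).map (toMPlus.map ((⟦p⟧ : P ⟶ Q) ≫ (⟦q⟧ : Q ⟶ R))) := by
      rw [Category.assoc, ihq]
      refine (Category.assoc _ _ _).symm.trans ((congrArg (· ≫ _) ihp).trans ?_)
      refine (Category.assoc _ _ _).trans (congrArg (_ ≫ ·) ?_)
      rw [toMPlus.map_comp]
      exact ((ofMPlus M).map_comp _ _).symm
    exact h
  | @tensor P P' Q Q' p q ihp ihq =>
    have h : ((⟦p⟧ : P ⟶ P') ⊗ₘ (⟦q⟧ : Q ⟶ Q')) ≫ (P'.tensor Q').toLetter.hom =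
        (P.tensor Q).toLetter.hom ≫
          (ofMPlus M).map (toMPlus.map ((⟦p⟧ : P ⟶ P') ⊗ₘ (⟦q⟧ : Q ⟶ Q'))) := by
      rw [toMPlus_map_tensorHom]
      refine (tensorHom_comp_tensorHom_assoc _ _ _ _ _).trans ?_
      rw [ihp, ihq]
      refine Eq.trans ?_ (congrArg (_ ≫ ·) (ofMPlus_map_tensorHom _ _)).symm
      refine Eq.trans ?_ (Category.assoc _ _ _).symm
      refine Eq.trans ?_ (congrArg (_ ≫ ·) (Iso.hom_inv_id_assoc _ _)).symm
      exact (tensorHom_comp_tensorHom_assoc _ _ _ _ _).symm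
    exact h
  | assocHom P Q R => exact associator_toLetter P Q R
  | assocInv P Q R =>
    exact comp_toLetter_of_comp_eq_id (associator_toLetter P Q R) (Iso.inv_hom_id (α_ P Q R))
      (isoHom_comp_symm _)
  | leftHom P => exact leftUnitor_toLetter P
  | leftInv P =>
    exact comp_toLetter_of_comp_eq_id (leftUnitor_toLetter P) (Iso.inv_hom_id (λ_ P))
      (isoHom_comp_symm _)
  | rightHom P => exact rightUnitor_toLetter P
  | rightInv P =>
    exact comp_toLetter_of_comp_eq_id (rightUnitor_toLetter P) (Iso.inv_hom_id (ρ_ P))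
      (isoHom_comp_symm _)
  | braid P Q =>
    refine (BraidedCategory.braiding_naturality_assoc P.toLetter.hom Q.toLetter.hom _).symm.trans
      ((congrArg (_ ≫ ·) (mu_isoHom_arrBraid _ _).symm).trans ?_)
    exact (Category.assoc _ _ _).symm
  | iso e => exact (Category.comp_id _).trans (Category.id_comp (isoHom e)).symm
  | gamma g f =>
    -- The first factor is `toLetter` of the two-letter word, and the rest is the image of `γ̄`
    -- under `toLoc`.
    have h : gammaHom g f = (muIso _ _).hom ≫ (muIso _ _).inv ≫ gammaHom g f :=
      (Iso.hom_inv_id_assoc _ _).symm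
    refine (Category.comp_id _).trans (h.trans ?_)
    refine congrArg (· ≫ _) ?_
    exact ((congrArg (· ≫ _) (id_tensorHom_id _ _)).trans (Category.id_comp _)).symm
  | mu A B =>
    refine (Category.comp_id _).trans ?_
    refine Eq.trans ?_ ((congrArg (_ ≫ ·) (isoHom_refl _)).trans (Category.comp_id _)).symm
    exact ((congrArg (· ≫ (muIso A B).hom) (id_tensorHom_id (of A) (of B))).trans
      (Category.id_comp _)).symm
  | muInv A B =>
    refine Eq.trans ?_ ((congrArg (_ ≫ ·) (isoHom_refl _)).trans (Category.comp_id _)).symm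
    refine (congrArg (_ ≫ ·)
      ((congrArg (· ≫ _) (id_tensorHom_id _ _)).trans (Category.id_comp _))).trans ?_
    exact Iso.inv_hom_id (muIso A B)
  | eps =>
    exact (Category.comp_id _).trans
      ((congrArg (_ ≫ ·) (isoHom_refl _)).trans (Category.comp_id _)).symm
  | epsInv =>
    exact (Iso.inv_hom_id (epsIso M)).trans
      ((congrArg (_ ≫ ·) (isoHom_refl _)).trans (Category.comp_id _)).symm

instance : (toMPlus (M := M)).Faithful where
  map_injective {P Q p q} h := by
    rw [← cancel_mono Q.toLetter.hom, toLetter_naturality, h, ← toLetter_naturality]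

instance : (toMPlus (M := M)).Full where
  map_surjective {P Q} q := by
    obtain ⟨q, rfl⟩ := Quotient.exists_rep q
    let q' : MPlus.PlusHom P.value.arrow Q.value.arrow := q
    -- Naturality of `toLetter` forces this preimage; its outer factors become identities in `M⁺`.
    refine ⟨P.toLetter.hom ≫ q'.toLoc ≫ Q.toLetter.inv, ?_⟩
    have h : toMPlus.map Q.toLetter.inv = 𝟙 Q.value := by
      have := toMPlus.map_comp Q.toLetter.hom Q.toLetter.inv
      rw [Iso.hom_inv_id, toMPlus_map_toLetter] at this
      exact (this.trans (Category.id_comp _)).symm.trans (toMPlus.map_id _)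
    rw [toMPlus.map_comp, toMPlus.map_comp, h, toMPlus_map_toLetter, toMPlus_map_toLoc]
    exact (Category.id_comp _).trans (Category.comp_id _)

instance : (toMPlus (M := M)).EssSurj where
  mem_essImage A := ⟨of A.arrow, ⟨Iso.refl A⟩⟩

instance : (toMPlus (M := M)).IsEquivalence where

end MLocPlus

end PlusConstruction

theorem mainTheorem5 {M : Type u} [Category.{v} M] [MonoidalCategory M] [SymmetricCategory M] :
    (∀ A B : Arrow M, Function.Bijective
      (PlusConstruction.MPlus.isoOf :
        (A ≅ B) → (PlusConstruction.MPlus.mk A ≅ PlusConstruction.MPlus.mk B))) ∧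
    ∃ (F : PlusConstruction.MLocPlus M ⥤ PlusConstruction.MPlus M) (_ : F.Braided),
      F.IsEquivalence :=
  ⟨PlusConstruction.MPlus.isoOf_bijective, PlusConstruction.MLocPlus.toMPlus, inferInstance,
    inferInstance⟩
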